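/- Let $A$ be a (not necessarily unital) $C^*$-algebra and let $E$ be a Hilbert $A$-module. Let $\{s_t\}_{t\ge0}$ be a strongly continuous one-parameter semigroup of adjointable isometries on $E$; that is, each $s_t\colon E\to E$ is a linear map having an adjoint $s_t^*$ and satisfying $\langle s_tx,s_ty\rangle=\langle x,y\rangle$ for all $x,y\in E$, one has $s_0=\mathrm{id}$ and $s_rs_t=s_{r+t}$ for all $r,t\ge0$, and $t\mapsto s_tx$ is norm continuous for every $x\in E$. Suppose that the semigroup is pure, that is, $\lim_{t\to\infty}\|s_t^*x\|=0$ for every $x\in E$. Then $\{s_t\}_{t\ge0}$ is unitarily equivalent to a standard right shift: there are a Hilbert $A$-module $F$ and a unitary $U\colon E\to L^2(\mathbb R_+,F)$ (a surjective linear map preserving the $A$-valued inner product) such that $U s_t=v_tU$ for all $t\ge0$. Here $L^2(\mathbb R_+,F):=L^2(\mathbb R_+)\otimes F$ is the external tensor product, i.e. the completion of the algebraic tensor product over $\mathbb C$ with respect to the norm $\|z\|=\|\langle z,z\rangle\|^{1/2}$ of the inner product determined by $\langle h\otimes y,h'\otimes y'\rangle=\langle h,h'\rangle\langle y,y'\rangle$,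 and $v_t$ is the standard right shift, i.e. $(v_tf)(x)=f(x-t)$ for $x\ge t$ and $(v_tf)(x)=0$ for $0\le x<t$; equivalently, $v_t$ is the operator $v_t^0\otimes\mathrm{id}_F$ with $v_t^0$ the scalar right shift on $L^2(\mathbb R_+)$. -/

import Mathlib

/-!
Hilbert modules over a `C*`-algebra `A` are Mathlib's `CStarModule A E` together with completeness
of `E`.  The algebra `A` need not be unital.  The inner product is linear in the second variable and
`⟨x, a • y⟩ = a * ⟨x, y⟩`; right Hilbert `B`-modules, with `⟨x, y b⟩ = ⟨x, y⟩ b`, are the case where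
`A` is the opposite algebra of `B`.

This file constructs the external tensor product `H ⊗ F` of a Hilbert space `H` and a Hilbert
`A`-module `F`, the Hilbert module `L²(ℝ₊, F) = L²(ℝ₊) ⊗ F`, and its standard right shift.
-/

open scoped TensorProduct NNReal

universe u v

set_option linter.unusedSectionVars false

namespace HilbertModule

noncomputable section

section ModuleAction

variable {A : Type*} [NonUnitalCStarAlgebra A] [PartialOrder A] [StarOrderedRing A]
  {F : Type*} [NormedAddCommGroup F] [NormedSpace ℂ F] [SMul A F] [CStarModule A F]

theorem eq_of_inner_right {x y : F} (h : ∀ z : F, inner A z x = inner A z y) : x = y := by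
  rw [← sub_eq_zero, ← CStarModule.inner_self (A := A)]
  rw [CStarModule.inner_sub_right, h, sub_self]

/-- The action of an element of the algebra as a complex linear map. -/
def actₗ (a : A) : F →ₗ[ℂ] F where
  toFun y := a • y
  map_add' x y := eq_of_inner_right (A := A) fun z => by simp [mul_add]
  map_smul' c x := eq_of_inner_right (A := A) fun z => by simp [mul_smul_comm]

theorem norm_act_le (a : A) (x : F) : ‖a • x‖ ≤ ‖a‖ * ‖x‖ := by
  refine (sq_le_sq₀ (norm_nonneg _) (by positivity)).mp ?_
  rw [CStarModule.norm_sq_eq A, mul_pow, CStarModule.norm_sq_eq A (x := x),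
    CStarModule.inner_op_smul_right, CStarModule.inner_op_smul_left]
  calc ‖a * (inner A x x * star a)‖ ≤ ‖a‖ * (‖inner A x x‖ * ‖star a‖) :=
        (norm_mul_le _ _).trans (by gcongr; exact norm_mul_le _ _)
    _ = ‖a‖ ^ 2 * ‖inner A x x‖ := by rw [norm_star]; ring

theorem uniformContinuousConstSMul : UniformContinuousConstSMul A F where
  uniformContinuous_const_smul a :=
    ((actₗ (F := F) a).mkContinuous ‖a‖ (norm_act_le a)).uniformContinuous

end ModuleAction

section CompletionModule

open UniformSpace

/-! The completion of a pre-Hilbert module is a Hilbert module. -/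

variable {A : Type*} [NonUnitalCStarAlgebra A] [PartialOrder A] [StarOrderedRing A]
  {X : Type*} [NormedAddCommGroup X] [NormedSpace ℂ X] [SMul A X] [CStarModule A X]

theorem completion_inner_coe (x y : X) :
    inner A (x : Completion X) (y : Completion X) = inner A x y :=
  (Completion.isDenseInducing_coe.prodMap Completion.isDenseInducing_coe).extend_eq
    (CStarModule.continuous_inner (A := A) (E := X)) (x, y)

theorem completion_continuous_inner :
    Continuous fun p : Completion X × Completion X => inner A p.1 p.2 := by
  let inner' : X →+ X →+ A :=
    { toFun := fun x => (CStarModule.innerₛₗ (A := A) x).toAddMonoidHom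
      map_zero' := by ext x; simp
      map_add' := fun x y => by ext z; simp }
  have h : Continuous fun p : X × X => inner' p.1 p.2 :=
    CStarModule.continuous_inner
  exact (Completion.isDenseInducing_toCompl X).extend_Z_bilin
    (Completion.isDenseInducing_toCompl X) h

theorem completion_continuous_inner' {Y : Type*} [TopologicalSpace Y] {f g : Y → Completion X}
    (hf : Continuous f) (hg : Continuous g) : Continuous fun x => inner A (f x) (g x) :=
  completion_continuous_inner.comp (hf.prodMk hg)

theorem completion_norm_eq (x : Completion X) :
    ‖x‖ = √‖inner A x x‖ := by
  refine Completion.induction_on x (isClosed_eq continuous_norm ?_) fun a => ?_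
  · exact (completion_continuous_inner' continuous_id continuous_id).norm.sqrt
  · rw [Completion.norm_coe, completion_inner_coe,
      CStarModule.norm_eq_sqrt_norm_inner_self (A := A)]

instance completionCStarModule : CStarModule A (Completion X) where
  inner_add_right {x y z} := by
    refine Completion.induction_on₃ x y z (isClosed_eq ?_ ?_) fun a b c => ?_
    · exact completion_continuous_inner' (by fun_prop) (by fun_prop)
    · exact (completion_continuous_inner' (by fun_prop) (by fun_prop)).add
        (completion_continuous_inner' (by fun_prop) (by fun_prop))
    · rw [← Completion.coe_add, completion_inner_coe, completion_inner_coe, completion_inner_coe,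
        CStarModule.inner_add_right]
  inner_self_nonneg {x} := by
    refine Completion.induction_on x ?_ fun a => ?_
    · exact CStarAlgebra.isClosed_nonneg.preimage
        (completion_continuous_inner' continuous_id continuous_id)
    · rw [completion_inner_coe]
      exact CStarModule.inner_self_nonneg
  inner_self {x} := by
    rw [← norm_eq_zero (a := x), completion_norm_eq (A := A),
      Real.sqrt_eq_zero (norm_nonneg _), norm_eq_zero]
  inner_op_smul_right {a x y} := by
    have := uniformContinuousConstSMul (A := A) (F := X)
    refine Completion.induction_on₂ x y (isClosed_eq ?_ ?_) fun b c => ?_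
    · exact completion_continuous_inner' continuous_fst
        ((uniformContinuous_const_smul a).continuous.comp continuous_snd)
    · exact (completion_continuous_inner' continuous_fst continuous_snd).const_mul a
    · rw [← Completion.coe_smul, completion_inner_coe, completion_inner_coe,
        CStarModule.inner_op_smul_right]
  inner_smul_right_complex {z x y} := by
    refine Completion.induction_on₂ x y (isClosed_eq ?_ ?_) fun b c => ?_
    · exact completion_continuous_inner' continuous_fst (continuous_snd.const_smul z)
    · have h : Continuous fun p : Completion X × Completion X => inner A p.1 p.2 :=
        completion_continuous_inner
      exact (continuous_const_smul z).comp h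
    · rw [← Completion.coe_smul, completion_inner_coe, completion_inner_coe,
        CStarModule.inner_smul_right_complex]
  star_inner x y := by
    refine Completion.induction_on₂ x y (isClosed_eq ?_ ?_) fun b c => ?_
    · exact (completion_continuous_inner' continuous_fst continuous_snd).star
    · exact completion_continuous_inner' continuous_snd continuous_fst
    · rw [completion_inner_coe, completion_inner_coe, CStarModule.star_inner]
  norm_eq_sqrt_norm_inner_self := completion_norm_eq

end CompletionModule

section AlgebraicTensor

variable (A H F : Type*) [NonUnitalCStarAlgebra A] [PartialOrder A] [StarOrderedRing A]
  [NormedAddCommGroup H] [InnerProductSpace ℂ H]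
  [NormedAddCommGroup F] [NormedSpace ℂ F] [SMul A F] [CStarModule A F]

/-- The sesquilinear map on the algebraic tensor product with
`⟨h ⊗ y, h' ⊗ y'⟩ = ⟨h, h'⟩ ⟨y, y'⟩`. -/
def innerForm : H ⊗[ℂ] F →ₗ⋆[ℂ] H ⊗[ℂ] F →ₗ[ℂ] A :=
  ((TensorProduct.lift <| TensorProduct.mapBilinear (.id ℂ) H F ℂ A).compr₂
    (TensorProduct.lid ℂ A).toLinearMap) ∘ₛₗ
      TensorProduct.map (innerₛₗ ℂ) (CStarModule.innerₛₗ (A := A))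

/-- The action `a • (h ⊗ y) = h ⊗ (a • y)` on the algebraic tensor product. -/
def actTensor (a : A) : H ⊗[ℂ] F →ₗ[ℂ] H ⊗[ℂ] F :=
  LinearMap.lTensor H (actₗ (F := F) a)

variable {A H F}

theorem innerForm_tmul (h h' : H) (y y' : F) :
    innerForm A H F (h ⊗ₜ y) (h' ⊗ₜ y') = inner ℂ h h' • inner A y y' := rfl

theorem actTensor_tmul (a : A) (h : H) (y : F) :
    actTensor A H F a (h ⊗ₜ y) = h ⊗ₜ (a • y) := rfl

theorem innerForm_act (a : A) (x y : H ⊗[ℂ] F) :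
    innerForm A H F x (actTensor A H F a y) = a * innerForm A H F x y := by
  induction y using TensorProduct.induction_on with
  | zero => simp
  | tmul h z =>
    induction x using TensorProduct.induction_on with
    | zero => simp
    | tmul h z => simp [actTensor_tmul, innerForm_tmul, mul_smul_comm]
    | add u v hu hv => simp [hu, hv, mul_add]
  | add u v hu hv => simp [hu, hv, mul_add]

theorem star_innerForm (x y : H ⊗[ℂ] F) :
    star (innerForm A H F x y) = innerForm A H F y x := by
  induction y using TensorProduct.induction_on with
  | zero => simp
  | tmul h z =>
    induction x using TensorProduct.induction_on with
    | zero => simp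
    | tmul h z => simp [innerForm_tmul]
    | add u v hu hv => simp [hu, hv]
  | add u v hu hv => simp [hu, hv]

theorem innerForm_sum {n : ℕ} (e : Fin n → H) (he : Orthonormal ℂ e) (y : Fin n → F) :
    innerForm A H F (∑ i, e i ⊗ₜ[ℂ] y i) (∑ i, e i ⊗ₜ[ℂ] y i) = ∑ i, inner A (y i) (y i) := by
  simp [innerForm_tmul, orthonormal_iff_ite.mp he]

theorem exists_orthonormal_sum (x : H ⊗[ℂ] F) :
    ∃ (n : ℕ) (e : Fin n → H) (y : Fin n → F), Orthonormal ℂ e ∧ x = ∑ i, e i ⊗ₜ[ℂ] y i := by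
  obtain ⟨E', iE', hz⟩ := TensorProduct.exists_finite_submodule_left_of_setFinite
    (R := ℂ) (M := H) (N := F) {x} (Set.finite_singleton x)
  obtain ⟨z, rfl⟩ := Set.singleton_subset_iff.mp hz
  let e := stdOrthonormalBasis ℂ E'
  suffices h : ∃ y : Fin (Module.finrank ℂ E') → F,
      LinearMap.rTensor F E'.subtype z = ∑ i, (e i : H) ⊗ₜ[ℂ] y i by
    obtain ⟨y, hy⟩ := h
    exact ⟨_, fun i => (e i : H), y, e.orthonormal.comp_linearIsometry E'.subtypeₗᵢ, hy⟩
  clear hz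
  induction z using TensorProduct.induction_on with
  | zero => exact ⟨fun _ => 0, by simp⟩
  | tmul h w =>
    refine ⟨fun i => e.repr h i • w, ?_⟩
    have hh : (h : H) = ∑ i, e.repr h i • (e i : H) := by
      conv_lhs => rw [← e.sum_repr h]
      simp
    rw [LinearMap.rTensor_tmul, Submodule.subtype_apply, hh, TensorProduct.sum_tmul]
    exact Finset.sum_congr rfl fun i _ => TensorProduct.smul_tmul _ _ _
  | add u v hu hv =>
    obtain ⟨y, hy⟩ := hu
    obtain ⟨y', hy'⟩ := hv
    refine ⟨fun i => y i + y' i, ?_⟩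
    rw [map_add, hy, hy', ← Finset.sum_add_distrib]
    exact Finset.sum_congr rfl fun i _ => (TensorProduct.tmul_add _ _ _).symm

theorem innerForm_self_nonneg (x : H ⊗[ℂ] F) : 0 ≤ innerForm A H F x x := by
  obtain ⟨n, e, y, he, rfl⟩ := exists_orthonormal_sum x
  rw [innerForm_sum e he]
  exact Finset.sum_nonneg fun i _ => CStarModule.inner_self_nonneg

theorem innerForm_self (x : H ⊗[ℂ] F) : innerForm A H F x x = 0 ↔ x = 0 := by
  refine ⟨fun hx => ?_, fun hx => by simp [hx]⟩
  obtain ⟨n, e, y, he, rfl⟩ := exists_orthonormal_sum x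
  rw [innerForm_sum e he,
    Finset.sum_eq_zero_iff_of_nonneg fun i _ => CStarModule.inner_self_nonneg] at hx
  exact Finset.sum_eq_zero fun i hi => by rw [CStarModule.inner_self.mp (hx i hi)]; simp

variable (A H F)

/-- The norm of the inner product on the algebraic tensor product. -/
@[reducible] def tensorNorm : Norm (H ⊗[ℂ] F) where
  norm x := √‖innerForm A H F x x‖

@[reducible] def tensorSMul : SMul A (H ⊗[ℂ] F) where
  smul a x := actTensor A H F a x

/-- The pre-Hilbert module structure of the algebraic tensor product. -/
@[reducible] def tensorModule :
    letI := tensorNorm A H F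
    letI := tensorSMul A H F
    CStarModule A (H ⊗[ℂ] F) :=
  letI := tensorNorm A H F
  letI := tensorSMul A H F
  { inner := fun x y => innerForm A H F x y
    inner_add_right := map_add _ _ _
    inner_self_nonneg := innerForm_self_nonneg _
    inner_self := innerForm_self _
    inner_op_smul_right := innerForm_act _ _ _
    inner_smul_right_complex := map_smul _ _ _
    star_inner := star_innerForm
    norm_eq_sqrt_norm_inner_self := fun _ => rfl }

theorem tensorCore :
    letI := tensorNorm A H F
    NormedSpace.Core ℂ (H ⊗[ℂ] F) :=
  letI := tensorNorm A H F
  letI := tensorSMul A H F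
  letI := tensorModule A H F
  CStarModule.normedSpaceCore A

@[reducible] def tensorNormedAddCommGroup : NormedAddCommGroup (H ⊗[ℂ] F) :=
  letI := tensorNorm A H F
  NormedAddCommGroup.ofCore (tensorCore A H F)

@[reducible] def tensorNormedSpace :
    @NormedSpace ℂ (H ⊗[ℂ] F) _ (tensorNormedAddCommGroup A H F).toSeminormedAddCommGroup :=
  letI := tensorNormedAddCommGroup A H F
  NormedSpace.ofCore (tensorCore A H F)

/-- The algebraic tensor product `H ⊗ F` over `ℂ` as a pre-Hilbert `A`-module. -/
def PreTensor (A H F : Type*) [NonUnitalCStarAlgebra A] [PartialOrder A] [StarOrderedRing A]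
    [NormedAddCommGroup H] [InnerProductSpace ℂ H]
    [NormedAddCommGroup F] [NormedSpace ℂ F] [SMul A F] [CStarModule A F] : Type _ := H ⊗[ℂ] F

namespace PreTensor

instance : NormedAddCommGroup (PreTensor A H F) := tensorNormedAddCommGroup A H F

instance : NormedSpace ℂ (PreTensor A H F) := tensorNormedSpace A H F

instance : SMul A (PreTensor A H F) := tensorSMul A H F

instance : CStarModule A (PreTensor A H F) := tensorModule A H F

variable {H F} in
/-- The elementary tensor `h ⊗ y`. -/
def tmul (h : H) (y : F) : PreTensor A H F := h ⊗ₜ[ℂ] y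

variable {A H F}

@[simp]
theorem inner_tmul (h h' : H) (y y' : F) :
    inner A (tmul A h y) (tmul A h' y') = inner ℂ h h' • inner A y y' := rfl

@[simp]
theorem smul_tmul (a : A) (h : H) (y : F) : a • tmul A h y = tmul A h (a • y) := rfl

@[elab_as_elim]
theorem induction {p : PreTensor A H F → Prop} (x : PreTensor A H F) (h0 : p 0)
    (ht : ∀ h y, p (tmul A h y)) (ha : ∀ x y, p x → p y → p (x + y)) : p x :=
  TensorProduct.induction_on (motive := p) x h0 ht ha

/-- For an isometry `T` of `H`, the operator `T ⊗ id` on the algebraic tensor product. -/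
def ampliation (T : H →ₗᵢ[ℂ] H) : PreTensor A H F →ₗ[ℂ] PreTensor A H F :=
  LinearMap.rTensor F T.toLinearMap

@[simp]
theorem ampliation_tmul (T : H →ₗᵢ[ℂ] H) (h : H) (y : F) :
    ampliation T (tmul A h y) = tmul A (T h) y := rfl

theorem inner_ampliation (T : H →ₗᵢ[ℂ] H) (x y : PreTensor A H F) :
    inner A (ampliation T x) (ampliation T y) = inner A x y := by
  induction y using induction with
  | h0 => simp
  | ht h z =>
    induction x using induction with
    | h0 => simp
    | ht h z => simp
    | ha u v hu hv => rw [map_add, CStarModule.inner_add_left, hu, hv, CStarModule.inner_add_left]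
  | ha u v hu hv => rw [map_add, CStarModule.inner_add_right, hu, hv, CStarModule.inner_add_right]

end PreTensor

end AlgebraicTensor

section Completion

open UniformSpace

/-- The external tensor product `H ⊗ F` of a Hilbert space `H` and a Hilbert `A`-module `F`:
the completion of the algebraic tensor product in the norm of the inner product
`⟨h ⊗ y, h' ⊗ y'⟩ = ⟨h, h'⟩ ⟨y, y'⟩`. -/
abbrev ExternalTensor (A H F : Type*) [NonUnitalCStarAlgebra A] [PartialOrder A]
    [StarOrderedRing A] [NormedAddCommGroup H] [InnerProductSpace ℂ H]
    [NormedAddCommGroup F] [NormedSpace ℂ F] [SMul A F] [CStarModule A F] : Type _ :=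
  Completion (PreTensor A H F)

namespace ExternalTensor

variable {A H F : Type*} [NonUnitalCStarAlgebra A] [PartialOrder A]
    [StarOrderedRing A] [NormedAddCommGroup H] [InnerProductSpace ℂ H]
    [NormedAddCommGroup F] [NormedSpace ℂ F] [SMul A F] [CStarModule A F]

variable (A) in
/-- The elementary tensor `h ⊗ y`. -/
def tmul (h : H) (y : F) : ExternalTensor A H F := (PreTensor.tmul A h y : PreTensor A H F)

@[simp]
theorem inner_tmul (h h' : H) (y y' : F) :
    inner A (tmul A h y) (tmul A h' y') = inner ℂ h h' • inner A y y' :=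
  completion_inner_coe _ _

/-- For an isometry `T` of `H`, the operator `T ⊗ id` on `H ⊗ F`. -/
def ampliation (T : H →ₗᵢ[ℂ] H) : ExternalTensor A H F →L[ℂ] ExternalTensor A H F :=
  ContinuousLinearMap.completion
    ((PreTensor.ampliation (A := A) (F := F) T).mkContinuous 1 fun x => by
      rw [one_mul, CStarModule.norm_eq_sqrt_norm_inner_self (A := A),
        PreTensor.inner_ampliation, ← CStarModule.norm_eq_sqrt_norm_inner_self (A := A)])

@[simp]
theorem ampliation_tmul (T : H →ₗᵢ[ℂ] H) (h : H) (y : F) :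
    ampliation T (tmul A h y) = tmul A (T h) y :=
  Completion.map_coe (ContinuousLinearMap.uniformContinuous _) _

end ExternalTensor

end Completion

section Shift

open MeasureTheory Set

/-- The Hilbert space `L²(ℝ₊)`. -/
abbrev L2Rplus : Type := Lp ℂ 2 (volume.restrict (Ici (0 : ℝ)))

theorem measurePreserving_sub (t : ℝ≥0) :
    MeasurePreserving (fun x : ℝ => x - t) (volume.restrict (Ici (t : ℝ)))
      (volume.restrict (Ici (0 : ℝ))) := by
  have h := (measurePreserving_sub_right (volume : Measure ℝ) (t : ℝ)).restrict_preimage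
    (measurableSet_Ici (a := (0 : ℝ)))
  simpa using h

theorem restrict_Ici (t : ℝ≥0) :
    (volume.restrict (Ici (0 : ℝ))).restrict (Ici (t : ℝ)) = volume.restrict (Ici (t : ℝ)) := by
  have h : Ici (t : ℝ) ∩ Ici 0 = Ici (t : ℝ) :=
    inter_eq_self_of_subset_left (Ici_subset_Ici.mpr t.2)
  rw [Measure.restrict_restrict measurableSet_Ici, h]

/-- The function `x ↦ f (x - t)` for `x ≥ t` and `x ↦ 0` otherwise. -/
def shiftFun (t : ℝ≥0) (f : ℝ → ℂ) (x : ℝ) : ℂ := if (t : ℝ) ≤ x then f (x - t) else 0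

theorem shiftFun_eq (t : ℝ≥0) (f : ℝ → ℂ) :
    shiftFun t f = (Ici (t : ℝ)).indicator (f ∘ fun x => x - t) := by
  ext x
  simp [shiftFun, indicator_apply]

theorem memLp_shiftFun (t : ℝ≥0) (f : L2Rplus) :
    MemLp (shiftFun t f) 2 (volume.restrict (Ici (0 : ℝ))) := by
  rw [shiftFun_eq, memLp_indicator_iff_restrict measurableSet_Ici, restrict_Ici]
  exact (Lp.memLp f).comp_measurePreserving (measurePreserving_sub t)

theorem shiftFun_congr (t : ℝ≥0) {f g : ℝ → ℂ} (h : f =ᵐ[volume.restrict (Ici (0 : ℝ))] g) :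
    shiftFun t f =ᵐ[volume.restrict (Ici (0 : ℝ))] shiftFun t g := by
  rw [shiftFun_eq, shiftFun_eq]
  have h' := (measurePreserving_sub t).quasiMeasurePreserving.ae_eq_comp h
  rw [← restrict_Ici t, Filter.EventuallyEq, ae_restrict_iff' measurableSet_Ici] at h'
  filter_upwards [h'] with x hx
  by_cases hxt : x ∈ Ici (t : ℝ)
  · rw [indicator_of_mem hxt, indicator_of_mem hxt, hx hxt]
  · rw [indicator_of_notMem hxt, indicator_of_notMem hxt]

/-- The right shift on `L²(ℝ₊)`: `(v_t f)(x) = f (x - t)` for `x ≥ t`, and `0` otherwise. -/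
def rightShift (t : ℝ≥0) : L2Rplus →ₗᵢ[ℂ] L2Rplus where
  toFun f := (memLp_shiftFun t f).toLp _
  map_add' f g := by
    rw [← MemLp.toLp_add]
    refine MemLp.toLp_congr _ _ ((shiftFun_congr t (Lp.coeFn_add f g)).trans (.of_eq ?_))
    ext x
    by_cases h : (t : ℝ) ≤ x <;> simp [shiftFun, h]
  map_smul' c f := by
    rw [RingHom.id_apply, ← MemLp.toLp_const_smul]
    refine MemLp.toLp_congr _ _ ((shiftFun_congr t (Lp.coeFn_smul c f)).trans (.of_eq ?_))
    ext x
    by_cases h : (t : ℝ) ≤ x <;> simp [shiftFun, h]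
  norm_map' f := by
    change ‖(memLp_shiftFun t f).toLp _‖ = ‖f‖
    rw [Lp.norm_toLp, Lp.norm_def, shiftFun_eq, eLpNorm_indicator_eq_eLpNorm_restrict
      measurableSet_Ici, restrict_Ici,
      eLpNorm_comp_measurePreserving (Lp.aestronglyMeasurable f) (measurePreserving_sub t)]

theorem coeFn_rightShift (t : ℝ≥0) (f : L2Rplus) :
    rightShift t f =ᵐ[volume.restrict (Ici (0 : ℝ))]
      fun x => if (t : ℝ) ≤ x then f (x - t) else 0 :=
  MemLp.coeFn_toLp (memLp_shiftFun t f)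

variable (A F : Type*) [NonUnitalCStarAlgebra A] [PartialOrder A] [StarOrderedRing A]
  [NormedAddCommGroup F] [NormedSpace ℂ F] [SMul A F] [CStarModule A F]

/-- The Hilbert module `L²(ℝ₊, F) = L²(ℝ₊) ⊗ F`. -/
abbrev L2RplusModule : Type _ := ExternalTensor A L2Rplus F

/-- The standard right shift on `L²(ℝ₊, F)` over the multiplicity module `F`: the operator
`v_t ⊗ id`, that is, `(v_t f)(x) = f (x - t)` for `x ≥ t`, and `0` otherwise. -/
def standardRightShift (t : ℝ≥0) : L2RplusModule A F →ₗ[ℂ] L2RplusModule A F :=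
  (ExternalTensor.ampliation (A := A) (F := F) (rightShift t)).toLinearMap

theorem standardRightShift_tmul (t : ℝ≥0) (h : L2Rplus) (y : F) :
    standardRightShift A F t (ExternalTensor.tmul A h y) =
      ExternalTensor.tmul A (rightShift t h) y :=
  ExternalTensor.ampliation_tmul _ _ _

end Shift

section Semigroups

variable {E : Type*} [NormedAddCommGroup E] [NormedSpace ℂ E]

/-- A one-parameter semigroup of linear maps. -/
structure IsSemigroup (s : ℝ≥0 → E →ₗ[ℂ] E) : Prop where
  zero : s 0 = LinearMap.id
  comp (r t : ℝ≥0) : s r ∘ₗ s t = s (r + t)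

def IsStronglyContinuous (s : ℝ≥0 → E →ₗ[ℂ] E) : Prop :=
  ∀ x : E, Continuous fun t => s t x

variable (A : Type*) [NonUnitalCStarAlgebra A] [PartialOrder A]
  [SMul A E] [CStarModule A E] {E' : Type*} [NormedAddCommGroup E'] [NormedSpace ℂ E']
  [SMul A E'] [CStarModule A E']

/-- Isometries of Hilbert modules preserve the `A`-valued inner product. -/
def IsIsometry (T : E →ₗ[ℂ] E') : Prop :=
  ∀ x y : E, inner A (T x) (T y) = inner A x y

/-- The map `S` is an adjoint of `T`. -/
def IsAdjoint (T : E → E') (S : E' → E) : Prop :=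
  ∀ (x : E) (y : E'), inner A (T x) y = inner A x (S y)

def IsAdjointable (T : E → E') : Prop := ∃ S : E' → E, IsAdjoint A T S

/-- The adjoint of an adjointable map. -/
def adjoint (T : E → E') (hT : IsAdjointable A T) : E' → E := hT.choose

/-- A semigroup of adjointable maps is pure if the adjoints converge strongly to `0`. -/
def IsPure (s : ℝ≥0 → E →ₗ[ℂ] E) (hs : ∀ t, IsAdjointable A (s t)) : Prop :=
  ∀ x : E, Filter.Tendsto (fun t => adjoint A (s t) (hs t) x) Filter.atTop (nhds 0)

/-- A unitary is a surjective isometry. -/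
structure IsUnitary (U : E →ₗ[ℂ] E') : Prop where
  isometry : IsIsometry A U
  surjective : Function.Surjective U

/-- Two semigroups are unitarily equivalent if a unitary intertwines them. -/
def UnitarilyEquivalent (s : ℝ≥0 → E →ₗ[ℂ] E) (s' : ℝ≥0 → E' →ₗ[ℂ] E') : Prop :=
  ∃ U : E →ₗ[ℂ] E', IsUnitary A U ∧ ∀ t, U ∘ₗ s t = s' t ∘ₗ U

end Semigroups

end

end HilbertModule

/-! Write `T t` for the adjoint of `S t`. In the model L²(ℝ₊, F), the joint eigenvectors of the
adjoint shifts with eigenvalue exp (-t) are exp (-x) ⊗ y, so F can be recovered inside E as the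
closed invariant subspace `expVectors T`. For eigenvectors y, z the inner product of `S r y` and `S
t z` is exp (-|r - t|) ⟨y, z⟩ (`inner_map_expVectors`). The shifts of the unit vector √2 exp (-x),
tensored with y and z, have the same inner products (`inner_rightShift_expVector_of_le`). Two total
families with equal Gram matrices are related by a unitary (`exists_isUnitary_of_inner_eq`), and
since both semigroups act on the families by translating the time index, it intertwines them.

What remains is totality. In L²(ℝ₊) a function orthogonal to all the shifts has vanishing weighted
integrals over half-lines, hence is zero (`span_rightShift_expVector`). In E this is
`expSpan_eq_top`. Closed submodules of a Hilbert module need not be complemented, so the argument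
approximates vectors directly instead of taking orthogonal complements. Purity reduces to vectors
killed by some `T τ`, and averaging along `T` reduces further to smooth ones. Such an x differs from
a resolvent vector by an eigenvector. Cut x into pieces `S (n h) (1 - S h T h) T (n h) x` and drop
the resolvent part of each. The errors have size O(h) and are mutually orthogonal, so over τ / h
pieces the total error is O(√h). -/

namespace HilbertModule

noncomputable section

open MeasureTheory Set Filter Topology

/-! ### Isometric semigroups and strong continuity of their adjoints -/

section WoldSemigroup

variable {A E : Type*} [NonUnitalCStarAlgebra A] [PartialOrder A] [StarOrderedRing A]
  [NormedAddCommGroup E] [NormedSpace ℂ E] [SMul A E] [CStarModule A E]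

/-- `S` is a strongly continuous semigroup of isometries whose adjoints are the maps `T`. -/
structure IsIsometricSemigroup (A : Type*) {E : Type*} [NonUnitalCStarAlgebra A] [PartialOrder A]
    [StarOrderedRing A] [NormedAddCommGroup E] [NormedSpace ℂ E] [SMul A E] [CStarModule A E]
    (S T : ℝ≥0 → E →L[ℂ] E) : Prop where
  zero (x : E) : S 0 x = x
  add (r t : ℝ≥0) (x : E) : S (r + t) x = S r (S t x)
  cont (x : E) : Continuous fun t => S t x
  adj (t : ℝ≥0) (x y : E) : inner A (S t x) y = inner A x (T t y)
  left_inv (t : ℝ≥0) (x : E) : T t (S t x) = x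

namespace IsIsometricSemigroup

variable {S T : ℝ≥0 → E →L[ℂ] E} (hS : IsIsometricSemigroup A S T)

include hS

theorem inner_map (t : ℝ≥0) (x y : E) : inner A (S t x) (S t y) = inner A x y := by
  rw [hS.adj, hS.left_inv]

theorem adj' (t : ℝ≥0) (x y : E) : inner A y (S t x) = inner A (T t y) x := by
  rw [← CStarModule.star_inner, hS.adj, CStarModule.star_inner]

theorem norm_map (t : ℝ≥0) (x : E) : ‖S t x‖ = ‖x‖ := by
  rw [CStarModule.norm_eq_sqrt_norm_inner_self (A := A), hS.inner_map,
    ← CStarModule.norm_eq_sqrt_norm_inner_self (A := A)]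

theorem norm_adjoint_le (t : ℝ≥0) (x : E) : ‖T t x‖ ≤ ‖x‖ := by
  have h : ‖T t x‖ ^ 2 ≤ ‖T t x‖ * ‖x‖ := by
    rw [CStarModule.norm_sq_eq A, ← hS.adj, ← hS.norm_map t (T t x)]
    exact CStarModule.norm_inner_le E
  rcases (norm_nonneg (T t x)).eq_or_lt with h0 | h0
  · rw [← h0]; exact norm_nonneg x
  · rw [sq] at h
    exact le_of_mul_le_mul_left h h0

theorem adjoint_zero (x : E) : T 0 x = x := by
  conv_lhs => rw [← hS.zero x]
  exact hS.left_inv 0 x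

theorem adjoint_add (r t : ℝ≥0) (x : E) : T (r + t) x = T r (T t x) := by
  refine eq_of_inner_right (A := A) fun z => ?_
  rw [← hS.adj, ← hS.adj, ← hS.adj, add_comm, hS.add]

theorem adjoint_comm (r t : ℝ≥0) (x : E) : T r (T t x) = T t (T r x) := by
  rw [← hS.adjoint_add, add_comm, hS.adjoint_add]

theorem adjoint_map_of_le {r t : ℝ≥0} (h : r ≤ t) (x : E) : T t (S r x) = T (t - r) x := by
  conv_lhs => rw [← tsub_add_cancel_of_le h]
  rw [hS.adjoint_add, hS.left_inv]

theorem adjoint_map_of_ge {r t : ℝ≥0} (h : t ≤ r) (x : E) : T t (S r x) = S (r - t) x := by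
  conv_lhs => rw [← add_tsub_cancel_of_le h]
  rw [hS.add, hS.left_inv]

/-- Since `T r = T t ∘ S (t - r)`, the difference is a contraction applied to an increment of the
isometries. This transfers strong continuity from `S` to the adjoints. -/
theorem norm_adjoint_sub_le {r t : ℝ≥0} (h : r ≤ t) (x : E) :
    ‖T t x - T r x‖ ≤ ‖S (t - r) x - x‖ := by
  have h1 : T t x - T r x = - T t (S (t - r) x - x) := by
    rw [map_sub, hS.adjoint_map_of_le tsub_le_self, tsub_tsub_cancel_of_le h, neg_sub]
  rw [h1, norm_neg]
  exact hS.norm_adjoint_le _ _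

theorem adjoint_cont (x : E) : Continuous fun t => T t x := by
  refine continuous_iff_continuousAt.mpr fun r => ?_
  rw [ContinuousAt, tendsto_iff_norm_sub_tendsto_zero]
  have hlim : Tendsto (fun t : ℝ≥0 => ‖S (nndist t r) x - x‖) (𝓝 r) (𝓝 0) := by
    have hc : Continuous fun t : ℝ≥0 => ‖S (nndist t r) x - x‖ :=
      (((hS.cont x).comp (by fun_prop)).sub continuous_const).norm
    simpa [hS.zero] using hc.tendsto r
  refine squeeze_zero (fun _ => norm_nonneg _) (fun t => ?_) hlim
  rcases le_total r t with h | h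
  · have : nndist t r = t - r := by
      rw [NNReal.nndist_eq, tsub_eq_zero_of_le h, max_eq_left zero_le]
    rw [this]; exact hS.norm_adjoint_sub_le h x
  · have : nndist t r = r - t := by
      rw [NNReal.nndist_eq, tsub_eq_zero_of_le h, max_eq_right zero_le]
    rw [this, norm_sub_rev]; exact hS.norm_adjoint_sub_le h x

theorem cont_toNNReal (x : E) : Continuous fun r : ℝ => S r.toNNReal x :=
  (hS.cont x).comp continuous_real_toNNReal

theorem adjoint_cont_toNNReal (x : E) : Continuous fun r : ℝ => T r.toNNReal x :=
  (hS.adjoint_cont x).comp continuous_real_toNNReal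

end IsIsometricSemigroup

/-! ### Eigenvectors of the adjoints and the resolvent -/

variable (A) in
/-- The eigenvectors with `T t y = exp (-t) • y` for all `t`.  In `L²(ℝ₊, F)`, with `T` the
adjoints of the right shift, these are the vectors `exp (-x) ⊗ y`. -/
def expVectors (T : ℝ≥0 → E →L[ℂ] E) : Submodule ℂ E :=
  ⨅ t : ℝ≥0, LinearMap.ker ((T t : E →ₗ[ℂ] E) - (Real.exp (-t) : ℂ) • LinearMap.id)

theorem mem_expVectors {T : ℝ≥0 → E →L[ℂ] E} {y : E} :
    y ∈ expVectors T ↔ ∀ t : ℝ≥0, T t y = Real.exp (-t) • y := by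
  simp [expVectors, Submodule.mem_iInf, sub_eq_zero, -Complex.ofReal_exp, Complex.coe_smul]

theorem isClosed_expVectors (T : ℝ≥0 → E →L[ℂ] E) : IsClosed (expVectors T : Set E) := by
  have : (expVectors T : Set E) = ⋂ t : ℝ≥0, {y | T t y = Real.exp (-t) • y} := by
    ext y; simp [mem_expVectors]
  rw [this]
  exact isClosed_iInter fun t => isClosed_eq (T t).continuous (by fun_prop)

/-- The resolvent `∫₀^∞ exp (-r) • S r g dr` of the generator. -/
def resolventAtOne (S : ℝ≥0 → E →L[ℂ] E) (g : E) : E :=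
  ∫ r in Ioi (0 : ℝ), Real.exp (-r) • S r.toNNReal g

/-- The closed span of the orbits of the vectors `expVectors T`. -/
def expSpan (S T : ℝ≥0 → E →L[ℂ] E) : Submodule ℂ E :=
  (Submodule.span ℂ {x | ∃ t : ℝ≥0, ∃ y ∈ expVectors T, x = S t y}).topologicalClosure

theorem map_mem_expSpan {S T : ℝ≥0 → E →L[ℂ] E} (t : ℝ≥0) {y : E} (hy : y ∈ expVectors T) :
    S t y ∈ expSpan S T :=
  Submodule.le_topologicalClosure _ (Submodule.subset_span ⟨t, y, hy, rfl⟩)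

namespace IsIsometricSemigroup

variable {S T : ℝ≥0 → E →L[ℂ] E} (hS : IsIsometricSemigroup A S T)

include hS

/-- Maps having an adjoint commute with the action of the algebra. This makes `expVectors T` a
Hilbert module, the future multiplicity module. -/
theorem act_mem_expVectors (a : A) {y : E} (hy : y ∈ expVectors T) : a • y ∈ expVectors T := by
  rw [mem_expVectors] at hy ⊢
  intro t
  refine eq_of_inner_right (A := A) fun z => ?_
  rw [← hS.adj, CStarModule.inner_op_smul_right, hS.adj, hy t, CStarModule.inner_smul_right_real,
    CStarModule.inner_smul_right_real, CStarModule.inner_op_smul_right, mul_smul_comm]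

/-- Moving `S r` across leaves `S (t - r)`, whose adjoint acts on y as a scalar. Only y has to be an
eigenvector. -/
theorem inner_map_expVectors {r t : ℝ≥0} (h : r ≤ t) {y z : E} (hy : y ∈ expVectors T) :
    inner A (S r y) (S t z) = Real.exp (r - t) • inner A y z := by
  rw [hS.adj, hS.adjoint_map_of_ge h, hS.adj', mem_expVectors.mp hy,
    CStarModule.inner_smul_left_real, NNReal.coe_sub h, neg_sub]

variable [CompleteSpace E]

omit [CompleteSpace E] in
theorem integrableOn_exp_smul_map (g : E) (a : ℝ) :
    IntegrableOn (fun r : ℝ => Real.exp (-r) • S r.toNNReal g) (Ioi a) := by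
  have h1 : IntegrableOn (fun r : ℝ => Real.exp (-r) * ‖g‖) (Ioi a) :=
    Integrable.mul_const (by simpa using (exp_neg_integrableOn_Ioi a one_pos).integrable) _
  refine h1.mono' ?_ (ae_of_all _ fun r => ?_)
  · exact ((Real.continuous_exp.comp continuous_neg).smul
      (hS.cont_toNNReal g)).aestronglyMeasurable
  · rw [norm_smul, hS.norm_map, Real.norm_eq_abs, Real.abs_exp]

theorem exp_smul_map_resolventAtOne (h : ℝ≥0) (g : E) :
    Real.exp (-h) • S h (resolventAtOne S g)
      = ∫ r in Ioi (h : ℝ), Real.exp (-r) • S r.toNNReal g := by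
  rw [resolventAtOne, ← (S h).integral_comp_comm (hS.integrableOn_exp_smul_map g 0),
    ← integral_smul]
  have := (measurePreserving_add_right (volume : Measure ℝ) (h : ℝ)).setIntegral_preimage_emb
    (MeasurableEquiv.addRight (h : ℝ)).measurableEmbedding
    (fun r => Real.exp (-r) • S r.toNNReal g) (Ioi (h : ℝ))
  rw [← this]
  simp only [preimage_add_const_Ioi, sub_self]
  refine setIntegral_congr_fun measurableSet_Ioi fun r hr => ?_
  have hr0 : (0 : ℝ) ≤ r := (mem_Ioi.mp hr).le
  rw [ContinuousLinearMap.map_smul_of_tower, smul_smul, ← Real.exp_add, ← hS.add,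
    Real.toNNReal_add hr0 h.coe_nonneg,
    Real.toNNReal_coe, add_comm h, neg_add, add_comm (-r)]

theorem resolventAtOne_sub (h : ℝ≥0) (g : E) :
    resolventAtOne S g - Real.exp (-h) • S h (resolventAtOne S g)
      = ∫ r in (0 : ℝ)..h, Real.exp (-r) • S r.toNNReal g := by
  rw [hS.exp_smul_map_resolventAtOne, resolventAtOne,
    intervalIntegral.integral_Ioi_sub_Ioi (hS.integrableOn_exp_smul_map g 0) h.coe_nonneg]

/-- Split the resolvent integral at h: the tail is exp (-h) times `S h` of the resolvent, which `T
h` undoes, and on [0, h] one has `T h ∘ S r = T (h - r)`. Thus the resolvent of g solves the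
equation of `IsSmoothPair` with right-hand side g. -/
theorem adjoint_resolventAtOne (h : ℝ≥0) (g : E) :
    T h (resolventAtOne S g) = Real.exp (-h) • resolventAtOne S g
      + ∫ r in (0 : ℝ)..h, Real.exp (-r) • T (h - r.toNNReal) g := by
  have h1 := hS.resolventAtOne_sub h g
  rw [sub_eq_iff_eq_add'] at h1
  conv_lhs => rw [h1]
  rw [map_add, ContinuousLinearMap.map_smul_of_tower, hS.left_inv,
    ← ContinuousLinearMap.intervalIntegral_comp_comm]
  · congr 1
    refine intervalIntegral.integral_congr fun r hr => ?_
    rw [uIcc_of_le h.coe_nonneg] at hr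
    have : r.toNNReal ≤ h := Real.toNNReal_le_iff_le_coe.mpr hr.2
    rw [ContinuousLinearMap.map_smul_of_tower, hS.adjoint_map_of_le this]
  · exact ((Real.continuous_exp.comp continuous_neg).smul
      (hS.cont_toNNReal g)).intervalIntegrable _ _

end IsIsometricSemigroup

/-! ### Smooth vectors and totality of the orbits of eigenvectors -/

/-- The integrated form of the differential equation `(d/dt + 1) T t x = T t g`. -/
def IsSmoothPair (T : ℝ≥0 → E →L[ℂ] E) (x g : E) : Prop :=
  ∀ t : ℝ≥0, T t x = Real.exp (-t) • x
    + ∫ r in (0 : ℝ)..t, Real.exp (-r) • T (t - r.toNNReal) g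

namespace IsIsometricSemigroup

variable {S T : ℝ≥0 → E →L[ℂ] E} (hS : IsIsometricSemigroup A S T) [CompleteSpace E]

include hS

/-- Two solutions of the same inhomogeneous equation differ by a solution of the homogeneous one,
which is an eigenvector. -/
theorem sub_resolventAtOne_mem {x g : E} (h : IsSmoothPair T x g) :
    x - resolventAtOne S g ∈ expVectors T := by
  rw [mem_expVectors]
  intro t
  rw [map_sub, h t, hS.adjoint_resolventAtOne, smul_sub]
  abel

omit [CompleteSpace E] in
theorem continuous_exp_smul_adjoint_sub (t : ℝ≥0) (g : E) :
    Continuous fun r : ℝ => Real.exp (-r) • T (t - r.toNNReal) g :=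
  (Real.continuous_exp.comp continuous_neg).smul
    ((hS.adjoint_cont g).comp (continuous_const.sub continuous_real_toNNReal))

theorem isSmoothPair_adjoint {x g : E} (h : IsSmoothPair T x g) (a : ℝ≥0) :
    IsSmoothPair T (T a x) (T a g) := by
  intro t
  rw [hS.adjoint_comm, h t, map_add, ContinuousLinearMap.map_smul_of_tower,
    ← ContinuousLinearMap.intervalIntegral_comp_comm _
      ((hS.continuous_exp_smul_adjoint_sub t g).intervalIntegrable _ _)]
  congr 1
  refine intervalIntegral.integral_congr fun r _ => ?_
  rw [ContinuousLinearMap.map_smul_of_tower, hS.adjoint_comm]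

/-- The part of the resolvent cut off by `1 - S h T h` is of order `h`. -/
theorem norm_sub_map_adjoint_resolventAtOne_le (h : ℝ≥0) (g : E) :
    ‖resolventAtOne S g - S h (T h (resolventAtOne S g))‖ ≤ 2 * h * ‖g‖ := by
  set I := ∫ r in (0 : ℝ)..h, Real.exp (-r) • S r.toNNReal g with hI
  have h1 : resolventAtOne S g = I + Real.exp (-h) • S h (resolventAtOne S g) := by
    rw [← sub_eq_iff_eq_add, hS.resolventAtOne_sub]
  -- `1 - S h T h` annihilates the range of `S h`, so only the integral over [0, h] survives.
  have h2 : resolventAtOne S g - S h (T h (resolventAtOne S g)) = I - S h (T h I) := by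
    have : T h (resolventAtOne S g) = T h I + Real.exp (-h) • resolventAtOne S g := by
      conv_lhs => rw [h1]
      rw [map_add, ContinuousLinearMap.map_smul_of_tower, hS.left_inv]
    rw [this, map_add, ContinuousLinearMap.map_smul_of_tower]
    nth_rewrite 1 [h1]
    abel
  have h3 : ‖I‖ ≤ h * ‖g‖ := by
    have := intervalIntegral.norm_integral_le_of_norm_le_const (a := 0) (b := (h : ℝ)) (C := ‖g‖)
      (f := fun r : ℝ => Real.exp (-r) • S r.toNNReal g) fun r hr => by
        rw [uIoc_of_le h.coe_nonneg] at hr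
        rw [norm_smul, hS.norm_map, Real.norm_eq_abs, Real.abs_exp]
        exact mul_le_of_le_one_left (norm_nonneg _) (Real.exp_le_one_iff.mpr (by linarith [hr.1]))
    rw [sub_zero, abs_of_nonneg h.coe_nonneg] at this
    linarith
  rw [h2]
  calc ‖I - S h (T h I)‖ ≤ ‖I‖ + ‖S h (T h I)‖ := norm_sub_le _ _
    _ ≤ ‖I‖ + ‖I‖ := by rw [hS.norm_map]; gcongr; exact hS.norm_adjoint_le _ _
    _ ≤ 2 * h * ‖g‖ := by linarith

omit [CompleteSpace E] in
/-- The wandering subspaces `S (n h) (ker (T h))` are mutually orthogonal. -/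
theorem norm_sq_sum_wandering_le (h : ℝ≥0) (N : ℕ) (b : ℕ → E) (hb : ∀ n, T h (b n) = 0) {C : ℝ}
    (hC : ∀ n, ‖b n‖ ≤ C) : ‖∑ n ∈ Finset.range N, S (n * h) (b n)‖ ^ 2 ≤ N * C ^ 2 := by
  have hlt {m n : ℕ} (hmn : m < n) : inner A (S (n * h) (b n)) (S (m * h) (b m)) = 0 := by
    have h1 : T (n * h) (S (m * h) (b m)) = 0 := by
      have hle : (m : ℝ≥0) * h ≤ n * h := by gcongr
      -- Since m < n, at least one factor `T h` is left to act on `b m`.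
      have h2 : (n : ℝ≥0) * h - m * h = ((n - m - 1 : ℕ) : ℝ≥0) * h + h := by
        rw [tsub_eq_iff_eq_add_of_le hle]
        obtain ⟨k, rfl⟩ := Nat.exists_eq_add_of_lt hmn
        have : m + k + 1 - m - 1 = k := by omega
        rw [this]; push_cast; ring
      rw [hS.adjoint_map_of_le hle, h2, hS.adjoint_add, hb, map_zero]
    rw [hS.adj, h1, CStarModule.inner_zero_right]
  have horth (m n : ℕ) (hmn : m ≠ n) : inner A (S (m * h) (b m)) (S (n * h) (b n)) = 0 := by
    rcases hmn.lt_or_gt with h1 | h1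
    · rw [← CStarModule.star_inner, hlt h1, star_zero]
    · exact hlt h1
  rw [CStarModule.norm_sq_eq A, CStarModule.inner_sum_left]
  have : ∀ m ∈ Finset.range N, inner A (S (m * h) (b m)) (∑ n ∈ Finset.range N, S (n * h) (b n))
      = inner A (b m) (b m) := by
    intro m hm
    rw [CStarModule.inner_sum_right, Finset.sum_eq_single_of_mem m hm
      fun n _ hn => horth m n hn.symm, hS.inner_map]
  rw [Finset.sum_congr rfl this]
  refine (norm_sum_le _ _).trans ?_
  calc ∑ m ∈ Finset.range N, ‖inner A (b m) (b m)‖ ≤ ∑ m ∈ Finset.range N, C ^ 2 := by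
        refine Finset.sum_le_sum fun m _ => ?_
        rw [← CStarModule.norm_sq_eq A]
        exact pow_le_pow_left₀ (norm_nonneg _) (hC m) 2
    _ = N * C ^ 2 := by simp

/-- The approximant `X N` replaces each `T (n h) x` in a telescoping sum for x by its eigenvector
part `Q (n h)`. The N + 1 omitted terms are orthogonal, each of norm at most 2 h ‖g‖ with h = τ / (N
+ 1), so the squared error is O(1 / N). -/
theorem mem_expSpan_of_isSmoothPair {x g : E} (hx : IsSmoothPair T x g) (τ : ℝ≥0)
    (hτ : T τ x = 0) : x ∈ expSpan S T := by
  set Q : ℝ≥0 → E := fun a => T a x - resolventAtOne S (T a g) with hQ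
  have hQmem (a : ℝ≥0) : Q a ∈ expVectors T :=
    hS.sub_resolventAtOne_mem (hS.isSmoothPair_adjoint hx a)
  set h : ℕ → ℝ≥0 := fun N => τ / (N + 1 : ℕ) with hh
  set X : ℕ → E := fun N => ∑ n ∈ Finset.range (N + 1),
    S (n * h N) (Q (n * h N) - S (h N) (T (h N) (Q (n * h N)))) with hX
  have hXmem (N : ℕ) : X N ∈ expSpan S T := by
    refine Submodule.sum_mem _ fun n _ => ?_
    rw [map_sub, mem_expVectors.mp (hQmem _), ContinuousLinearMap.map_smul_of_tower,
      ContinuousLinearMap.map_smul_of_tower, ← hS.add,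
      ← Complex.coe_smul]
    exact Submodule.sub_mem _ (map_mem_expSpan _ (hQmem _))
      (Submodule.smul_mem _ _ (map_mem_expSpan _ (hQmem _)))
  -- The sum telescopes to `x - S τ (T τ x)`, and the last term vanishes by `hτ`.
  have hxsum (N : ℕ) : x = ∑ n ∈ Finset.range (N + 1),
      S (n * h N) (T (n * h N) x - S (h N) (T (h N) (T (n * h N) x))) := by
    have hstep (n : ℕ) : S (n * h N) (T (n * h N) x - S (h N) (T (h N) (T (n * h N) x)))
        = S (n * h N) (T (n * h N) x)
          - S ((n + 1 : ℕ) * h N) (T ((n + 1 : ℕ) * h N) x) := by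
      have h1 : ((n + 1 : ℕ) : ℝ≥0) * h N = n * h N + h N := by push_cast; ring
      rw [map_sub, h1, hS.add, hS.adjoint_comm, hS.adjoint_add]
    rw [Finset.sum_congr rfl fun n _ => hstep n,
      Finset.sum_range_sub' fun n : ℕ => S (n * h N) (T (n * h N) x)]
    have h2 : ((N + 1 : ℕ) : ℝ≥0) * h N = τ := mul_div_cancel₀ _ (by positivity)
    rw [h2, hτ, map_zero, sub_zero, Nat.cast_zero, zero_mul, hS.zero, hS.adjoint_zero]
  have hdist (N : ℕ) : ‖X N - x‖ ^ 2 ≤ 4 * τ ^ 2 * ‖g‖ ^ 2 / (N + 1) := by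
    set b : ℕ → E := fun n => resolventAtOne S (T (n * h N) g)
      - S (h N) (T (h N) (resolventAtOne S (T (n * h N) g))) with hb
    have h1 : x - X N = ∑ n ∈ Finset.range (N + 1), S (n * h N) (b n) := by
      nth_rewrite 1 [hxsum N]
      rw [hX, ← Finset.sum_sub_distrib]
      refine Finset.sum_congr rfl fun n _ => ?_
      rw [← map_sub]
      congr 1
      simp only [hQ, hb, map_sub]
      abel
    have h2 := hS.norm_sq_sum_wandering_le (h N) (N + 1) b
      -- `b n` is in the kernel of `T h` because `T h (1 - S h T h) = 0`.
      (fun n => by simp [hb, hS.left_inv]) (C := 2 * h N * ‖g‖) fun n =>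
        (hS.norm_sub_map_adjoint_resolventAtOne_le _ _).trans
          (by gcongr; exact hS.norm_adjoint_le _ _)
    rw [norm_sub_rev, h1]
    refine h2.trans (le_of_eq ?_)
    simp only [hh, NNReal.coe_div]
    push_cast
    field_simp
    ring
  have hlim : Tendsto X atTop (𝓝 x) := by
    rw [tendsto_iff_norm_sub_tendsto_zero]
    have h1 : Tendsto (fun N : ℕ => 4 * (τ : ℝ) ^ 2 * ‖g‖ ^ 2 / (N + 1)) atTop (𝓝 0) :=
      tendsto_const_nhds.div_atTop
        (tendsto_atTop_add_const_right _ _ tendsto_natCast_atTop_atTop)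
    have h2 := (squeeze_zero (fun N => sq_nonneg _) hdist h1).sqrt
    simpa using h2
  exact (Submodule.isClosed_topologicalClosure _).mem_of_tendsto hlim
    (Eventually.of_forall hXmem)

/-- The averages `ε⁻¹ ∫₀^ε T r w dr` are smooth. -/
theorem isSmoothPair_average (w : E) (ε : ℝ≥0) :
    IsSmoothPair T ((ε : ℝ)⁻¹ • ∫ r in (0 : ℝ)..ε, T r.toNNReal w)
      (((ε : ℝ)⁻¹ • ∫ r in (0 : ℝ)..ε, T r.toNNReal w) + (ε : ℝ)⁻¹ • (T ε w - w)) := by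
  set c : ℝ → E := fun r => T r.toNNReal w with hc
  have hcont : Continuous c := hS.adjoint_cont_toNNReal w
  set G : ℝ → E := fun t => ∫ r in (0 : ℝ)..t, c r with hG
  have hGd (t : ℝ) : HasDerivAt G (c t) t :=
    intervalIntegral.integral_hasDerivAt_right (hcont.intervalIntegrable _ _)
      (hcont.stronglyMeasurableAtFilter _ _) hcont.continuousAt
  set x : E := (ε : ℝ)⁻¹ • G ε with hx
  have hTx (t : ℝ≥0) : T t x = (ε : ℝ)⁻¹ • (G (t + ε) - G t) := by
    rw [hx, ContinuousLinearMap.map_smul_of_tower, hG,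
      ← ContinuousLinearMap.intervalIntegral_comp_comm _
      (hcont.intervalIntegrable _ _),
      intervalIntegral.integral_interval_sub_left (hcont.intervalIntegrable _ _)
        (hcont.intervalIntegrable _ _)]
    have h1 := intervalIntegral.integral_comp_add_left c (a := 0) (b := (ε : ℝ)) (t : ℝ)
    rw [add_zero] at h1
    rw [← h1]
    congr 1
    refine intervalIntegral.integral_congr fun r hr => ?_
    rw [uIcc_of_le ε.coe_nonneg] at hr
    simp only [hc]
    rw [← hS.adjoint_add, Real.toNNReal_add t.coe_nonneg hr.1, Real.toNNReal_coe]
  -- The second summand is the derivative of `T t x` at t = 0, so g is (d/dt + 1) `T t x` there.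
  set g : E := x + (ε : ℝ)⁻¹ • (T ε w - w) with hg
  -- With the integrating factor, φ t = exp t • `T t x` for t ≥ 0. Writing it through `G` defines it
  -- on all of ℝ, so it has a two-sided derivative at 0.
  set φ : ℝ → E := fun t => Real.exp t • ((ε : ℝ)⁻¹ • (G (t + ε) - G t)) with hφ
  have hφd (t : ℝ) (ht : 0 ≤ t) : HasDerivAt φ (Real.exp t • T t.toNNReal g) t := by
    have h1 : HasDerivAt φ (Real.exp t • ((ε : ℝ)⁻¹ • (c (t + ε) - c t))
        + Real.exp t • ((ε : ℝ)⁻¹ • (G (t + ε) - G t))) t :=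
      (Real.hasDerivAt_exp t).smul
        ((((hGd (t + ε)).comp_add_const t ε).sub (hGd t)).const_smul _)
    convert h1 using 1
    lift t to ℝ≥0 using ht
    have h2 : (t + ε : ℝ).toNNReal = t + ε := by
      rw [Real.toNNReal_add t.coe_nonneg ε.coe_nonneg, Real.toNNReal_coe, Real.toNNReal_coe]
    rw [Real.toNNReal_coe, hg, map_add, hTx,
      ContinuousLinearMap.map_smul_of_tower, map_sub, ← hS.adjoint_add, smul_add,
      add_comm]
    simp only [hc, h2, Real.toNNReal_coe]
  intro t
  have h1 : ∫ r in (0 : ℝ)..t, Real.exp r • T r.toNNReal g = φ t - φ 0 := by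
    refine intervalIntegral.integral_eq_sub_of_hasDerivAt (fun r hr => ?_) ?_
    · rw [uIcc_of_le t.coe_nonneg] at hr
      exact hφd r hr.1
    · exact (Real.continuous_exp.smul (hS.adjoint_cont_toNNReal g)).intervalIntegrable _ _
  have h2 : φ 0 = x := by simp [hφ, hG, hx]
  have h3 : φ t = Real.exp t • T t x := by simp only [hφ]; rw [hTx]
  rw [h2, h3] at h1
  have h4 : ∫ r in (0 : ℝ)..t, Real.exp (-r) • T (t - r.toNNReal) g
      = Real.exp (-t) • ∫ r in (0 : ℝ)..t, Real.exp r • T r.toNNReal g := by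
    have h5 := intervalIntegral.integral_comp_sub_left (a := 0) (b := (t : ℝ))
      (fun r : ℝ => Real.exp r • T r.toNNReal g) (t : ℝ)
    rw [sub_self, sub_zero] at h5
    rw [← h5, ← intervalIntegral.integral_smul]
    refine intervalIntegral.integral_congr fun r hr => ?_
    rw [uIcc_of_le t.coe_nonneg] at hr
    rw [smul_smul, ← Real.exp_add, NNReal.sub_def, Real.coe_toNNReal _ hr.1]
    congr 2
    ring
  rw [h4, h1, smul_sub, smul_smul (Real.exp (-t)) (Real.exp t), ← Real.exp_add, neg_add_cancel,
    Real.exp_zero, one_smul]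
  abel

/-- Averages of a vector killed by `T τ` are still killed by `T τ`, because the adjoints commute.
They are smooth and converge to the vector as ε → 0, so the smooth case yields all of these kernels.
-/
theorem expSpan_eq_top (hpure : ∀ x, Tendsto (fun t => T t x) atTop (𝓝 0)) :
    expSpan S T = ⊤ := by
  have hclosed : IsClosed (expSpan S T : Set E) := Submodule.isClosed_topologicalClosure _
  have hker (τ : ℝ≥0) (w : E) (hw : T τ w = 0) : w ∈ expSpan S T := by
    have hcont : Continuous fun r : ℝ => T r.toNNReal w := hS.adjoint_cont_toNNReal w
    have hd : HasDerivAt (fun t : ℝ => ∫ r in (0 : ℝ)..t, T r.toNNReal w) w 0 := by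
      have := intervalIntegral.integral_hasDerivAt_right (a := 0) (b := 0)
        (hcont.intervalIntegrable _ _)
        (hcont.stronglyMeasurableAtFilter _ _) hcont.continuousAt
      simpa [hS.adjoint_zero] using this
    have hlim := hd.tendsto_slope_zero_right
    simp only [zero_add, intervalIntegral.integral_same, sub_zero] at hlim
    refine hclosed.mem_of_tendsto hlim ?_
    filter_upwards [self_mem_nhdsWithin] with ε hε
    lift ε to ℝ≥0 using (mem_Ioi.mp hε).le
    refine hS.mem_expSpan_of_isSmoothPair (hS.isSmoothPair_average w ε) τ ?_
    rw [ContinuousLinearMap.map_smul_of_tower, ← ContinuousLinearMap.intervalIntegral_comp_comm _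
      (hcont.intervalIntegrable _ _)]
    simp [hS.adjoint_comm τ, hw]
  refine eq_top_iff.mpr fun w _ => ?_
  -- Purity enters here: `S t (T t w)` has the norm of `T t w`, and the difference is killed by `T
  -- t`.
  have hlim : Tendsto (fun t => w - S t (T t w)) atTop (𝓝 w) := by
    have h1 : Tendsto (fun t => S t (T t w)) atTop (𝓝 0) := by
      rw [tendsto_zero_iff_norm_tendsto_zero]
      simp_rw [hS.norm_map]
      exact tendsto_zero_iff_norm_tendsto_zero.mp (hpure w)
    simpa using tendsto_const_nhds.sub h1
  refine hclosed.mem_of_tendsto hlim (Eventually.of_forall fun t => hker t _ ?_)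
  rw [map_sub, hS.left_inv, sub_self]

end IsIsometricSemigroup

end WoldSemigroup

/-! ### The exponential vector in the scalar model L²(ℝ₊) -/

section ExponentialVector

theorem rightShift_rightShift (r t : ℝ≥0) (f : L2Rplus) :
    rightShift r (rightShift t f) = rightShift (r + t) f := by
  refine Lp.ext ?_
  refine (MemLp.coeFn_toLp (memLp_shiftFun r (rightShift t f))).trans
    ((shiftFun_congr r (MemLp.coeFn_toLp (memLp_shiftFun t f))).trans
      (.trans (.of_eq ?_) (MemLp.coeFn_toLp (memLp_shiftFun (r + t) f)).symm))
  ext x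
  have ht := t.coe_nonneg
  by_cases h1 : (r : ℝ) ≤ x
  · by_cases h2 : (t : ℝ) ≤ x - r
    · have h3 : ((r + t : ℝ≥0) : ℝ) ≤ x := by push_cast; linarith
      rw [shiftFun, if_pos h1, shiftFun, if_pos h2, shiftFun, if_pos h3, sub_sub, NNReal.coe_add]
    · have h3 : ¬ ((r + t : ℝ≥0) : ℝ) ≤ x := by push_cast; linarith
      rw [shiftFun, if_pos h1, shiftFun, if_neg h2, shiftFun, if_neg h3]
  · have h3 : ¬ ((r + t : ℝ≥0) : ℝ) ≤ x := by push_cast; linarith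
    rw [shiftFun, if_neg h1, shiftFun, if_neg h3]

/-- The function `√2 exp (-x)`. -/
def expFun (x : ℝ) : ℝ := √2 * Real.exp (-x)

theorem continuous_expFun : Continuous expFun :=
  continuous_const.mul (Real.continuous_exp.comp continuous_neg)

theorem expFun_sub (x t : ℝ) : expFun (x - t) = Real.exp t * expFun x := by
  rw [expFun, expFun, neg_sub, sub_eq_add_neg, Real.exp_add]
  ring

theorem expFun_mul_self (x : ℝ) : expFun x * expFun x = 2 * Real.exp (-2 * x) := by
  have h : Real.exp (-2 * x) = Real.exp (-x) * Real.exp (-x) := by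
    rw [← Real.exp_add]; congr 1; ring
  rw [expFun, h, mul_mul_mul_comm, Real.mul_self_sqrt zero_le_two]

theorem integral_expFun_mul_self (t : ℝ) :
    ∫ x in Ici t, expFun x * expFun x = Real.exp (-2 * t) := by
  simp_rw [expFun_mul_self]
  rw [integral_const_mul, integral_Ici_eq_integral_Ioi, integral_exp_mul_Ioi (by norm_num)]
  ring

theorem memLp_expFun :
    MemLp (fun x => (expFun x : ℂ)) 2 (volume.restrict (Ici (0 : ℝ))) := by
  have hc : Continuous fun x => (expFun x : ℂ) := Complex.continuous_ofReal.comp continuous_expFun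
  rw [memLp_two_iff_integrable_sq_norm hc.aestronglyMeasurable]
  have h : (fun x => ‖(expFun x : ℂ)‖ ^ 2) = fun x => 2 * Real.exp (-2 * x) := by
    ext x
    rw [Complex.norm_real, Real.norm_eq_abs, sq_abs, sq, expFun_mul_self]
  rw [h]
  exact ((integrableOn_Ici_iff_integrableOn_Ioi).mpr
    (integrableOn_exp_mul_Ioi (by norm_num) 0)).integrable.const_mul 2

/-- The unit vector `√2 exp (-x)` of `L²(ℝ₊)`. -/
def expVector : L2Rplus := memLp_expFun.toLp _

theorem coeFn_rightShift_expVector (t : ℝ≥0) :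
    rightShift t expVector =ᵐ[volume.restrict (Ici (0 : ℝ))]
      (Ici (t : ℝ)).indicator fun x => ((Real.exp t * expFun x : ℝ) : ℂ) := by
  refine (MemLp.coeFn_toLp (memLp_shiftFun t expVector)).trans
    ((shiftFun_congr t (MemLp.coeFn_toLp memLp_expFun)).trans (.of_eq ?_))
  ext x
  rw [shiftFun_eq]
  congr 1
  ext y
  simp only [Function.comp_apply]
  rw [expFun_sub]

theorem inner_rightShift_expVector (t : ℝ≥0) (f : L2Rplus) :
    inner ℂ (rightShift t expVector) f
      = Real.exp t • ∫ x in Ici (t : ℝ), expFun x • f x := by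
  rw [L2.inner_def, ← integral_smul, ← restrict_Ici t,
    ← integral_indicator (measurableSet_Ici (a := (t : ℝ)))]
  refine integral_congr_ae ?_
  filter_upwards [coeFn_rightShift_expVector t] with x hx
  rw [hx]
  by_cases hxt : x ∈ Ici (t : ℝ)
  · rw [indicator_of_mem hxt, indicator_of_mem hxt, smul_smul, RCLike.inner_apply,
      Complex.conj_ofReal, Complex.real_smul, mul_comm]
  · rw [indicator_of_notMem hxt, indicator_of_notMem hxt, inner_zero_left]

/-- On [t, ∞) both shifts are multiples of the same exponential, and its tail integral exp (-2 t)
turns the factor exp (r + t) into exp (r - t). -/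
theorem inner_rightShift_expVector_of_le {r t : ℝ≥0} (h : r ≤ t) :
    inner ℂ (rightShift r expVector) (rightShift t expVector) = (Real.exp (r - t) : ℂ) := by
  rw [← inner_conj_symm, inner_rightShift_expVector]
  have h1 : ∫ x in Ici (t : ℝ), expFun x • rightShift r expVector x
      = ∫ x in Ici (t : ℝ), ((Real.exp r * (expFun x * expFun x) : ℝ) : ℂ) := by
    refine integral_congr_ae ?_
    have h2 := coeFn_rightShift_expVector r
    have h3 := ae_restrict_of_ae (s := Ici (t : ℝ)) h2
    rw [restrict_Ici] at h3
    filter_upwards [h3, ae_restrict_mem measurableSet_Ici] with x hx hxt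
    have hxr : x ∈ Ici (r : ℝ) := (NNReal.coe_le_coe.mpr h).trans hxt
    rw [hx, indicator_of_mem hxr, Complex.real_smul, ← Complex.ofReal_mul]
    congr 1
    ring
  rw [h1, integral_complex_ofReal, integral_const_mul, integral_expFun_mul_self, Complex.real_smul,
    ← Complex.ofReal_mul, Complex.conj_ofReal, ← Real.exp_add, ← Real.exp_add]
  congr 2
  ring

theorem integrable_expFun_smul (f : L2Rplus) :
    Integrable (fun x => expFun x • f x) (volume.restrict (Ici (0 : ℝ))) := by
  refine (L2.integrable_inner expVector f).congr ?_
  filter_upwards [MemLp.coeFn_toLp memLp_expFun] with x hx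
  rw [expVector, hx, RCLike.inner_apply, Complex.conj_ofReal, Complex.real_smul, mul_comm]

/-- A function on `ℝ₊` is zero if its integrals over all half-lines are zero. -/
theorem ae_eq_zero_of_forall_setIntegral_Ici {k : ℝ → ℂ}
    (hk : Integrable k (volume.restrict (Ici (0 : ℝ))))
    (h : ∀ t : ℝ≥0, ∫ x in Ici (t : ℝ), k x = 0) : k =ᵐ[volume.restrict (Ici (0 : ℝ))] 0 := by
  have htotal : ∫ x in Ici (0 : ℝ), k x = 0 := h 0
  refine hk.ae_eq_zero_of_forall_setIntegral_eq_zero fun s hs hfin => ?_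
  clear hfin
  -- Half-lines form a π-system generating the Borel sets. The complement step needs the total
  -- integral, which is the case t = 0.
  induction s, hs using MeasurableSpace.induction_on_inter
    ((BorelSpace.measurable_eq (α := ℝ)).trans (borel_eq_generateFrom_Ici ℝ)) isPiSystem_Ici with
  | empty => simp
  | basic s hs =>
    obtain ⟨a, rfl⟩ := hs
    rw [Measure.restrict_restrict measurableSet_Ici, Ici_inter_Ici]
    exact h ⟨a ⊔ 0, le_sup_right⟩
  | compl s hs ih => rw [setIntegral_compl hs hk, ih, htotal, sub_zero]
  | iUnion f hd hf ih =>
    rw [integral_iUnion hf hd hk.integrableOn]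
    simp [ih]

/-- For f orthogonal to every shift, the integrals of `expFun • f` over all half-lines [t, ∞)
vanish. Hence this product is zero almost everywhere, and the weight never vanishes. -/
theorem span_rightShift_expVector :
    (Submodule.span ℂ (range fun t : ℝ≥0 => rightShift t expVector)).topologicalClosure = ⊤ := by
  rw [Submodule.topologicalClosure_eq_top_iff, Submodule.eq_bot_iff]
  intro f hf
  have h1 (t : ℝ≥0) : ∫ x in Ici (t : ℝ), expFun x • f x = 0 := by
    have h2 := Submodule.inner_right_of_mem_orthogonal
      (Submodule.subset_span (mem_range_self t)) hf
    rw [inner_rightShift_expVector] at h2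
    exact (smul_eq_zero.mp h2).resolve_left (Real.exp_ne_zero _)
  refine Lp.ext ?_
  filter_upwards [ae_eq_zero_of_forall_setIntegral_Ici (integrable_expFun_smul f) h1,
    Lp.coeFn_zero ℂ 2 (volume.restrict (Ici (0 : ℝ)))] with x hx hx0
  rw [hx0]
  exact (smul_eq_zero.mp hx).resolve_left
    (mul_ne_zero (by positivity) (Real.exp_ne_zero _))

end ExponentialVector

/-! ### Unitaries from equal Gram matrices -/

section Unitary

variable {A X Y : Type*} [NonUnitalCStarAlgebra A] [PartialOrder A] [StarOrderedRing A]
  [NormedAddCommGroup X] [NormedSpace ℂ X] [SMul A X] [CStarModule A X]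
  [NormedAddCommGroup Y] [NormedSpace ℂ Y] [SMul A Y] [CStarModule A Y]

theorem denseRange_linearCombination {V ι : Type*} [NormedAddCommGroup V] [NormedSpace ℂ V]
    {a : ι → V} (ha : (Submodule.span ℂ (range a)).topologicalClosure = ⊤) :
    DenseRange (Finsupp.linearCombination ℂ a) := by
  rw [← Finsupp.range_linearCombination, ← Submodule.dense_iff_topologicalClosure_eq_top] at ha
  exact ha

omit [StarOrderedRing A] in
theorem inner_eq_inner_symm {x y : X} {x' y' : Y} (h : inner A x y = inner A x' y') :
    inner A y x = inner A y' x' := by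
  rw [← CStarModule.star_inner, h, CStarModule.star_inner]

theorem intertwines_of_total {X Y ι : Type*} [NormedAddCommGroup X] [NormedSpace ℂ X]
    [NormedAddCommGroup Y] [NormedSpace ℂ Y] {a : ι → X} {b : ι → Y}
    (ha : (Submodule.span ℂ (range a)).topologicalClosure = ⊤) {U : X →L[ℂ] Y}
    (hU : ∀ i, U (a i) = b i) {S : X →L[ℂ] X} {V : Y →L[ℂ] Y} {σ : ι → ι}
    (hS : ∀ i, S (a i) = a (σ i)) (hV : ∀ i, V (b i) = b (σ i)) (x : X) :
    U (S x) = V (U x) := by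
  have h : EqOn (U ∘L S) (V ∘L U) (range a) := by
    rintro _ ⟨i, rfl⟩
    simp [hS, hU, hV]
  exact DFunLike.congr_fun (ContinuousLinearMap.ext_on
    (Submodule.dense_iff_topologicalClosure_eq_top.mpr ha) h) x

/-- Two total families with the same Gram matrix are related by a unitary. -/
theorem exists_isUnitary_of_inner_eq [CompleteSpace X] [CompleteSpace Y] {ι : Type*}
    {a : ι → X} {b : ι → Y} (hab : ∀ i j, inner A (b i) (b j) = inner A (a i) (a j))
    (ha : (Submodule.span ℂ (range a)).topologicalClosure = ⊤)
    (hb : (Submodule.span ℂ (range b)).topologicalClosure = ⊤) :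
    ∃ U : X →L[ℂ] Y, IsUnitary A (U : X →ₗ[ℂ] Y) ∧ ∀ i, U (a i) = b i := by
  -- Formal combinations of the indices avoid any choice of representatives: equal Gram matrices
  -- give α and β equal norms, so α u ↦ β u is well defined and extends by continuity.
  set α := Finsupp.linearCombination ℂ a with hα
  set β := Finsupp.linearCombination ℂ b with hβ
  have hαd : DenseRange α := denseRange_linearCombination ha
  have hβd : DenseRange β := denseRange_linearCombination hb
  have hin (u w : ι →₀ ℂ) : inner A (β u) (β w) = inner A (α u) (α w) := by
    simp only [hα, hβ, Finsupp.linearCombination_apply, Finsupp.sum, CStarModule.inner_sum_left,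
      CStarModule.inner_sum_right, CStarModule.inner_smul_left_complex,
      CStarModule.inner_smul_right_complex, hab]
  have hnorm (u : ι →₀ ℂ) : ‖β u‖ = ‖α u‖ := by
    rw [CStarModule.norm_eq_sqrt_norm_inner_self (A := A), hin,
      ← CStarModule.norm_eq_sqrt_norm_inner_self (A := A)]
  have hU (u : ι →₀ ℂ) : β.extendOfNorm α (α u) = β u :=
    LinearMap.extendOfNorm_eq hαd ⟨1, fun u => by rw [one_mul, hnorm]⟩ u
  set U : X →L[ℂ] Y := β.extendOfNorm α with hUdef
  have hiso (x y : X) : inner A (U x) (U y) = inner A x y := by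
    refine hαd.induction_on₂ ?_ (fun u w => ?_) x y
    · have hX : Continuous fun p : X × X => inner A p.1 p.2 := CStarModule.continuous_inner
      have hY : Continuous fun p : Y × Y => inner A p.1 p.2 := CStarModule.continuous_inner
      exact isClosed_eq (hY.comp ((U.continuous.comp continuous_fst).prodMk
        (U.continuous.comp continuous_snd))) hX
    · rw [hU, hU, hin]
  have hUn (x : X) : ‖U x‖ = ‖x‖ := by
    rw [CStarModule.norm_eq_sqrt_norm_inner_self (A := A), hiso,
      ← CStarModule.norm_eq_sqrt_norm_inner_self (A := A)]
  refine ⟨U, ⟨hiso, fun y => ?_⟩, fun i => ?_⟩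
  · have hcl : IsClosed (range U) :=
      (AddMonoidHomClass.isometry_of_norm U hUn).isClosedEmbedding.isClosed_range
    have hsub : range β ⊆ range U := by
      rintro _ ⟨u, rfl⟩
      exact ⟨α u, hU u⟩
    exact closure_minimal hsub hcl (hβd y)
  · simpa [hα, hβ] using hU (Finsupp.single i 1)

end Unitary

/-! ### Total families in the external tensor product -/

section Tensor

variable {A H F : Type*} [NonUnitalCStarAlgebra A] [PartialOrder A] [StarOrderedRing A]
  [NormedAddCommGroup H] [InnerProductSpace ℂ H]
  [NormedAddCommGroup F] [NormedSpace ℂ F] [SMul A F] [CStarModule A F]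

namespace ExternalTensor

/-- The elementary tensor `h ⊗ y` as a linear map of `h`. -/
def tmulRight (A H : Type*) {F : Type*} [NonUnitalCStarAlgebra A] [PartialOrder A]
    [StarOrderedRing A] [NormedAddCommGroup H] [InnerProductSpace ℂ H] [NormedAddCommGroup F]
    [NormedSpace ℂ F] [SMul A F] [CStarModule A F] (y : F) : H →L[ℂ] ExternalTensor A H F :=
  LinearMap.mkContinuous
    { toFun := fun h => tmul A h y
      map_add' := fun h h' => by
        rw [tmul, tmul, tmul, ← UniformSpace.Completion.coe_add]
        exact congrArg _ (TensorProduct.add_tmul h h' y)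
      map_smul' := fun c h => by
        rw [tmul, tmul, RingHom.id_apply, ← UniformSpace.Completion.coe_smul]
        exact congrArg _ (TensorProduct.smul_tmul' c h y).symm } ‖y‖ fun h => by
    refine (sq_le_sq₀ (norm_nonneg _) (by positivity)).mp ?_
    change ‖tmul A h y‖ ^ 2 ≤ _
    rw [CStarModule.norm_sq_eq A, inner_tmul, norm_smul, mul_pow, CStarModule.norm_sq_eq A,
      inner_self_eq_norm_sq_to_K, norm_pow, mul_comm]
    simp

theorem span_tmul_of_span {ι : Type*} {e : ι → H}
    (he : (Submodule.span ℂ (range e)).topologicalClosure = ⊤) :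
    (Submodule.span ℂ (range fun p : ι × F => tmul A (e p.1) p.2)).topologicalClosure = ⊤ := by
  set K := (Submodule.span ℂ (range fun p : ι × F => tmul A (e p.1) p.2)).topologicalClosure
    with hK
  have hcl : IsClosed (K : Set (ExternalTensor A H F)) := Submodule.isClosed_topologicalClosure _
  have htmul (h : H) (y : F) : tmul A h y ∈ K := by
    have h1 : (Submodule.span ℂ (range e)).topologicalClosure ≤
        K.comap (tmulRight A H y : H →ₗ[ℂ] ExternalTensor A H F) := by
      refine Submodule.topologicalClosure_minimal _ (Submodule.span_le.mpr ?_)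
        (hcl.preimage (tmulRight A H y).continuous)
      rintro _ ⟨i, rfl⟩
      exact Submodule.le_topologicalClosure _ (Submodule.subset_span ⟨(i, y), rfl⟩)
    rw [he] at h1
    exact h1 (Submodule.mem_top (x := h))
  refine eq_top_iff.mpr fun x _ => ?_
  refine UniformSpace.Completion.induction_on x hcl fun z => ?_
  induction z using PreTensor.induction with
  | h0 => exact K.zero_mem
  | ht h y => exact htmul h y
  | ha u v hu hv =>
    rw [UniformSpace.Completion.coe_add]
    exact K.add_mem hu hv

end ExternalTensor

end Tensor

/-! ### Invariant subspaces as pre-Hilbert modules -/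

section InvariantSubspace

variable {A E : Type*} [NonUnitalCStarAlgebra A] [PartialOrder A] [StarOrderedRing A]
  [NormedAddCommGroup E] [NormedSpace ℂ E] [SMul A E] [CStarModule A E]

/-- The restriction of the action to an invariant subspace. -/
@[reducible] def submoduleSMul (K : Submodule ℂ E) (hK : ∀ (a : A), ∀ y ∈ K, a • y ∈ K) :
    SMul A K where
  smul a y := ⟨a • (y : E), hK a y y.2⟩

/-- An invariant subspace of a Hilbert module is a pre-Hilbert module. -/
@[reducible] def submoduleCStarModule (K : Submodule ℂ E) (hK : ∀ (a : A), ∀ y ∈ K, a • y ∈ K) :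
    letI := submoduleSMul K hK
    CStarModule A K :=
  letI := submoduleSMul K hK
  { inner := fun x y => inner A (x : E) (y : E)
    inner_add_right := CStarModule.inner_add_right
    inner_self_nonneg := CStarModule.inner_self_nonneg
    inner_self := CStarModule.inner_self.trans Submodule.coe_eq_zero
    inner_op_smul_right := CStarModule.inner_op_smul_right
    inner_smul_right_complex := CStarModule.inner_smul_right_complex
    star_inner := fun x y => CStarModule.star_inner (x : E) (y : E)
    norm_eq_sqrt_norm_inner_self := fun x =>
      CStarModule.norm_eq_sqrt_norm_inner_self (A := A) (x : E) }

end InvariantSubspace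

/-! ### The equivalence with the standard shift -/

section UnitaryEquivalence

variable {A : Type v} {E : Type u} [NonUnitalCStarAlgebra A] [PartialOrder A]
  [StarOrderedRing A] [NormedAddCommGroup E] [NormedSpace ℂ E] [SMul A E] [CStarModule A E]
  [CompleteSpace E]

/-- The multiplicity module enters only through a map J onto the eigenvectors that preserves inner
products. Linearity of J is not needed, since only Gram matrices and spans are compared. -/
theorem IsIsometricSemigroup.unitarilyEquivalent {S T : ℝ≥0 → E →L[ℂ] E}
    (hS : IsIsometricSemigroup A S T) (hpure : ∀ x, Tendsto (fun t => T t x) atTop (𝓝 0))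
    {F : Type*} [NormedAddCommGroup F] [NormedSpace ℂ F] [SMul A F] [CStarModule A F]
    (J : F → E) (hJ : ∀ y z, inner A (J y) (J z) = inner A y z)
    (hJr : range J = expVectors T) :
    UnitarilyEquivalent A (fun t => (S t : E →ₗ[ℂ] E)) (standardRightShift A F) := by
  have hJmem (y : F) : J y ∈ expVectors T := hJr.subset (mem_range_self y)
  set a : ℝ≥0 × F → E := fun p => S p.1 (J p.2) with ha
  set b : ℝ≥0 × F → L2RplusModule A F :=
    fun p => ExternalTensor.tmul A (rightShift p.1 expVector) p.2 with hb
  have hle {p q : ℝ≥0 × F} (h : p.1 ≤ q.1) : inner A (b p) (b q) = inner A (a p) (a q) := by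
    rw [ha, hb, ExternalTensor.inner_tmul, inner_rightShift_expVector_of_le h,
      hS.inner_map_expVectors h (hJmem _), hJ, Complex.coe_smul]
  have hab (p q : ℝ≥0 × F) : inner A (b p) (b q) = inner A (a p) (a q) := by
    rcases le_total p.1 q.1 with h | h
    · exact hle h
    · exact inner_eq_inner_symm (hle h)
  have haspan : (Submodule.span ℂ (range a)).topologicalClosure = ⊤ := by
    rw [← hS.expSpan_eq_top hpure, expSpan]
    congr 2
    ext x
    constructor
    · rintro ⟨p, rfl⟩
      exact ⟨p.1, J p.2, hJmem _, rfl⟩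
    · rintro ⟨t, y, hy, rfl⟩
      obtain ⟨z, rfl⟩ := hJr.superset hy
      exact ⟨(t, z), rfl⟩
  have hbspan : (Submodule.span ℂ (range b)).topologicalClosure = ⊤ :=
    ExternalTensor.span_tmul_of_span (H := L2Rplus)
      (e := fun t : ℝ≥0 => rightShift t expVector) span_rightShift_expVector
  obtain ⟨U, hU, hUab⟩ := exists_isUnitary_of_inner_eq (A := A) hab haspan hbspan
  refine ⟨U, hU, fun t => LinearMap.ext fun x => ?_⟩
  refine intertwines_of_total haspan hUab (S := S t)
    (V := ExternalTensor.ampliation (rightShift t)) (σ := fun p => (t + p.1, p.2))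
    (fun p => (hS.add _ _ _).symm) (fun p => ?_) x
  rw [hb, ExternalTensor.ampliation_tmul, rightShift_rightShift]

/-- A pure isometric semigroup is a standard right shift with multiplicity module
`expVectors T`. -/
theorem IsIsometricSemigroup.exists_unitarilyEquivalent {S T : ℝ≥0 → E →L[ℂ] E}
    (hS : IsIsometricSemigroup A S T) (hpure : ∀ x, Tendsto (fun t => T t x) atTop (𝓝 0)) :
    ∃ (F : Type u) (_ : NormedAddCommGroup F) (_ : NormedSpace ℂ F) (_ : SMul A F)
      (_ : CStarModule A F) (_ : CompleteSpace F),
      UnitarilyEquivalent A (fun t => (S t : E →ₗ[ℂ] E)) (standardRightShift A F) := by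
  have hK : ∀ a : A, ∀ y ∈ expVectors T, a • y ∈ expVectors T :=
    fun a y hy => hS.act_mem_expVectors a hy
  let _ : SMul A (expVectors T) := submoduleSMul (expVectors T) hK
  let _ : CStarModule A (expVectors T) := submoduleCStarModule (expVectors T) hK
  exact ⟨expVectors T, inferInstance, inferInstance, inferInstance, inferInstance,
    (isClosed_expVectors T).completeSpace_coe,
    hS.unitarilyEquivalent hpure (fun y => (y : E)) (fun _ _ => rfl) Subtype.range_coe⟩

omit [CompleteSpace E] in
/-- A strongly continuous semigroup of adjointable isometries and its adjoints consist of bounded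
operators. -/
theorem exists_isIsometricSemigroup (s : ℝ≥0 → E →ₗ[ℂ] E)
    (hs : IsSemigroup s) (hcont : IsStronglyContinuous s)
    (hiso : ∀ t, IsIsometry A (s t)) (hadj : ∀ t, IsAdjointable A (s t)) :
    ∃ S T : ℝ≥0 → E →L[ℂ] E, IsIsometricSemigroup A S T ∧
      (∀ t, (S t : E →ₗ[ℂ] E) = s t) ∧ ∀ t x, T t x = adjoint A (s t) (hadj t) x := by
  have hspec (t : ℝ≥0) : IsAdjoint A (s t) (adjoint A (s t) (hadj t)) := (hadj t).choose_spec
  have hnorm (t : ℝ≥0) (x : E) : ‖s t x‖ = ‖x‖ := by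
    rw [CStarModule.norm_eq_sqrt_norm_inner_self (A := A), hiso t,
      ← CStarModule.norm_eq_sqrt_norm_inner_self (A := A)]
  -- The adjoint is given only as a function. Its linearity follows from nondegeneracy of the inner
  -- product, its boundedness from Cauchy–Schwarz.
  let Tₗ (t : ℝ≥0) : E →ₗ[ℂ] E :=
    { toFun := adjoint A (s t) (hadj t)
      map_add' := fun x y => eq_of_inner_right (A := A) fun z => by
        rw [← hspec t, CStarModule.inner_add_right, CStarModule.inner_add_right, hspec t, hspec t]
      map_smul' := fun c x => eq_of_inner_right (A := A) fun z => by
        rw [← hspec t, RingHom.id_apply, CStarModule.inner_smul_right_complex,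
          CStarModule.inner_smul_right_complex, hspec t] }
  have hTnorm (t : ℝ≥0) (x : E) : ‖Tₗ t x‖ ≤ 1 * ‖x‖ := by
    have h : ‖Tₗ t x‖ ^ 2 ≤ ‖Tₗ t x‖ * ‖x‖ := by
      rw [CStarModule.norm_sq_eq A]
      change ‖inner A (Tₗ t x) (adjoint A (s t) (hadj t) x)‖ ≤ _
      rw [← hspec t, ← hnorm t (Tₗ t x)]
      exact CStarModule.norm_inner_le E
    rw [one_mul]
    rcases (norm_nonneg (Tₗ t x)).eq_or_lt with h0 | h0
    · rw [← h0]; exact norm_nonneg x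
    · rw [sq] at h
      exact le_of_mul_le_mul_left h h0
  refine ⟨fun t => (s t).mkContinuous 1 fun x => by rw [one_mul, hnorm],
    fun t => (Tₗ t).mkContinuous 1 (hTnorm t), ⟨fun x => ?_, fun r t x => ?_, hcont,
      fun t x y => hspec t x y, fun t x => ?_⟩, fun t => rfl, fun t x => rfl⟩
  · change s 0 x = x
    rw [hs.zero, LinearMap.id_apply]
  · change s (r + t) x = s r (s t x)
    rw [← hs.comp, LinearMap.comp_apply]
  · refine eq_of_inner_right (A := A) fun z => ?_
    change inner A z (adjoint A (s t) (hadj t) (s t x)) = inner A z x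
    rw [← hspec t, hiso t]

end UnitaryEquivalence

end

end HilbertModule

theorem theorem1p1 {A : Type v} {E : Type u} [NonUnitalCStarAlgebra A] [PartialOrder A]
    [StarOrderedRing A] [NormedAddCommGroup E] [NormedSpace ℂ E] [SMul A E] [CStarModule A E]
    [CompleteSpace E] (s : ℝ≥0 → E →ₗ[ℂ] E)
    (hs : HilbertModule.IsSemigroup s) (hcont : HilbertModule.IsStronglyContinuous s)
    (hiso : ∀ t, HilbertModule.IsIsometry A (s t))
    (hadj : ∀ t, HilbertModule.IsAdjointable A (s t))
    (hpure : HilbertModule.IsPure A s hadj) :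
    ∃ (F : Type u) (_ : NormedAddCommGroup F) (_ : NormedSpace ℂ F) (_ : SMul A F)
      (_ : CStarModule A F) (_ : CompleteSpace F),
      HilbertModule.UnitarilyEquivalent A s (HilbertModule.standardRightShift A F) := by
  obtain ⟨S, T, hS, hSs, hT⟩ :=
    HilbertModule.exists_isIsometricSemigroup s hs hcont hiso hadj
  have h := hS.exists_unitarilyEquivalent fun x => by simpa only [hT] using hpure x
  simpa only [hSs] using h
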